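/- Setting. Let $\mathcal G=(\mathcal V,\mathcal E)$ be a finite directed graph with destination $d\in\mathcal V$, link capacities $C_{ij}$ and unit link costs $e_{ij}$, and let $\mathcal L=\{1,\dots,L\}$ be the set of packet lifetimes. Time is slotted. In slot $t$, $a_i^{(l)}(t)\ge 0$ packets of lifetime $l\in\mathcal L$ arrive at node $i$; the vectors $\mathbf a(t)$ are i.i.d. over time and bounded, $a_d^{(l)}(t)=0$, and $\lambda_i^{(l)}=\mathbb E\{a_i^{(l)}(t)\}$. A policy chooses in each slot $t$, from the information available then (which $\mathbf a(t)$ is independent of, and which contains $\mathbf a(0),\dots,\mathbf a(t-1)$ and possibly additional randomness), real flow variables $x_{ij}^{(l)}(t)\ge 0$, $(i,j)\in\mathcal E$, $l\in\mathcal L$, with $x_{dj}^{(l)}(t)=0$ (the destination consumes packets) and $x_{ij}^{(1)}(t)=0$ for $j\ne d$ (such packets would be outdated on arrival). Variables with a lifetime outside $\mathcal L$ are zero. Write $x_{ij}=\sum_{l\in\mathcal L}x_{ij}^{(l)}$, $x_{i\to}^{(l)}=\sum_{j:(i,j)\in\mathcal E}x_{ij}^{(l)}$, $x_{\to i}^{(l)}=\sum_{j:(j,i)\in\mathcal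 E}x_{ji}^{(l)}$, $x_{\to d}=\sum_{l\in\mathcal L}x_{\to d}^{(l)}$, and a superscript $(\ge l)$ for summation over lifetimes $l,\dots,L$. Let $\overline{\{z(t)\}}=\lim_{T\to\infty}\frac1T\sum_{t=0}^{T-1}z(t)$; a constraint or objective written with it includes the existence of the limit. Let $h(\mathbf x(t))=\sum_{(i,j)\in\mathcal E}e_{ij}x_{ij}(t)$ be the operational cost, and fix a reliability level $\gamma\in\mathbb R$. Problem $\mathscr P_1$ (actual network): minimize $\overline{\{\mathbb E\,h(\mathbf x(t))\}}$ over policies such that $\overline{\{\mathbb E\,x_{\to d}(t)\}}\ge\gamma\|\boldsymbol\lambda\|_1$, $\overline{\{\mathbb E\,x_{ij}(t)\}}\le C_{ij}$ for all $(i,j)\in\mathcal E$, and $x_{i\to}^{(l)}(t)\le Q_i^{(l)}(t)$ for all $i\in\mathcal V$, $l\in\mathcal L$, $t\ge 0$, where the queues start from a given non-negative initial backlog and evolve by $Q_i^{(l)}(t+1)=Q_i^{(l+1)}(t)-x_{i\to}^{(l+1)}(t)+x_{\to i}^{(l+1)}(t)+a_i^{(l)}(t)$ for $i\ne d$, $l\in\mathcal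 L$, with $Q_i^{(0)}=Q_i^{(L+1)}=0$ and $Q_d^{(l)}=0$. Problem $\mathscr P_2$ (virtual network): minimize $\overline{\{\mathbb E\,h(\mathbf x(t))\}}$ over policies such that $\overline{\{\mathbb E\,x_{\to d}(t)\}}\ge\gamma\|\boldsymbol\lambda\|_1$, $x_{ij}(t)\le C_{ij}$ for all $(i,j)\in\mathcal E$, $t\ge 0$, and $\overline{\{\mathbb E\,x_{i\to}^{(\ge l)}(t)\}}\le\overline{\{\mathbb E\,x_{\to i}^{(\ge l+1)}(t)\}}+\lambda_i^{(\ge l)}$ for all $i\in\mathcal V$, $l\in\mathcal L$. Claim. $\mathscr P_1$ and $\mathscr P_2$ have the same optimal value ($+\infty$ if infeasible). Moreover, if one of the two problems is feasible, this value is finite and is attained as a minimum in both. -/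

import Mathlib

open MeasureTheory ProbabilityTheory Filter Topology

/-- A capacitated packet network: a finite directed graph with a destination node, a maximum
lifetime `L` (lifetimes are `1, …, L`), link capacities and unit link costs. The values of
`cap` and `cost` matter only on links of the graph. -/
structure PacketNetwork (V : Type*) where
  /-- the directed graph of links -/
  graph : Digraph V
  /-- the destination `d` -/
  dest : V
  /-- the maximum lifetime -/
  L : ℕ
  /-- the capacity `C i j` of the link `(i, j)` -/
  cap : V → V → ℝ
  /-- the cost `e i j` of sending one unit of data over the link `(i, j)` -/
  cost : V → V → ℝ

/-- Flow variables of one slot: `x i j l` is the amount of lifetime `l` data sent from `i`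
to `j`. -/
abbrev FlowVec (V : Type*) := V → V → ℕ → ℝ

/-- Quantities indexed by a node and a lifetime (arrivals, backlogs). -/
abbrev NodeVec (V : Type*) := V → ℕ → ℝ

namespace PacketNetwork

noncomputable section

variable {V : Type*} [Fintype V] (N : PacketNetwork V)

open Classical in
/-- Outgoing neighbours of `i`. -/
def outNbrs (i : V) : Finset V := Finset.univ.filter fun j => N.graph.Adj i j

open Classical in
/-- Incoming neighbours of `i`. -/
def inNbrs (i : V) : Finset V := Finset.univ.filter fun j => N.graph.Adj j i

/-- Outgoing flow of lifetime `l` at node `i`. -/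
def outflow (x : FlowVec V) (i : V) (l : ℕ) : ℝ := ∑ j ∈ N.outNbrs i, x i j l

/-- Incoming flow of lifetime `l` at node `i`. -/
def inflow (x : FlowVec V) (i : V) (l : ℕ) : ℝ := ∑ j ∈ N.inNbrs i, x j i l

/-- Outgoing flow of lifetime at least `l` at node `i`. -/
def outflowGE (x : FlowVec V) (i : V) (l : ℕ) : ℝ := ∑ k ∈ Finset.Icc l N.L, N.outflow x i k

/-- Incoming flow of lifetime at least `l` at node `i`. -/
def inflowGE (x : FlowVec V) (i : V) (l : ℕ) : ℝ := ∑ k ∈ Finset.Icc l N.L, N.inflow x i k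

/-- Total flow on the link `(i, j)`. -/
def linkFlow (x : FlowVec V) (i j : V) : ℝ := ∑ l ∈ Finset.Icc 1 N.L, x i j l

/-- Total flow received by the destination (packets of every lifetime `1, …, L`). -/
def delivered (x : FlowVec V) : ℝ := ∑ l ∈ Finset.Icc 1 N.L, N.inflow x N.dest l

/-- Operational cost of the flow variables of one slot. -/
def opCost (x : FlowVec V) : ℝ := ∑ i, ∑ j ∈ N.outNbrs i, N.cost i j * N.linkFlow x i j

/-- Legitimate flow variables of one slot: non-negative; supported on the links and on the
lifetimes `1, …, L`; nothing leaves the destination, where packets are consumed; packets of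
lifetime `1`, which would be outdated on arrival elsewhere, are only sent to the destination. -/
structure IsFlow (x : FlowVec V) : Prop where
  nonneg : ∀ i j l, 0 ≤ x i j l
  off_links : ∀ i j l, ¬ N.graph.Adj i j → x i j l = 0
  off_lifetimes : ∀ i j l, l ∉ Finset.Icc 1 N.L → x i j l = 0
  dest_out : ∀ j l, x N.dest j l = 0
  last_slot : ∀ i j, j ≠ N.dest → x i j 1 = 0

open Classical in
/-- Backlogs `Q t i l` along one sample path of arrivals `a` and decisions `x`, from the initial
backlog `q₀`. There is no backlog of lifetime `0` (outdated packets are dropped) or above `L`,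
and none at the destination. -/
def backlog (q₀ : NodeVec V) (a : ℕ → NodeVec V) (x : ℕ → FlowVec V) : ℕ → NodeVec V
  | 0 => fun i l => if i ≠ N.dest ∧ l ∈ Finset.Icc 1 N.L then q₀ i l else 0
  | t + 1 => fun i l =>
      if i ≠ N.dest ∧ l ∈ Finset.Icc 1 N.L then
        backlog q₀ a x t i (l + 1) - N.outflow (x t) i (l + 1) + N.inflow (x t) i (l + 1) + a t i l
      else 0

variable {Ω : Type*} {mΩ : MeasurableSpace Ω}

/-- Exogenous arrivals on a filtered probability space. `ℱ t` is the information available when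
the decisions of slot `t` are made; the arrivals `a t` of slot `t` enter the queues at its end, so
they are known at slot `t + 1` and independent of `ℱ t`. The vectors `a t` are i.i.d. over time
(independence over time follows from `adapted` and `indep`), with arbitrary joint law over nodes
and lifetimes, bounded, and nothing arrives at the destination. -/
structure IsArrivalStream (μ : Measure Ω) (ℱ : Filtration ℕ mΩ)
    (a : ℕ → Ω → NodeVec V) : Prop where
  adapted : ∀ t, Measurable[ℱ (t + 1)] (a t)
  indep : ∀ t, Indep (ℱ t) (MeasurableSpace.comap (a t) inferInstance) μ
  identDistrib : ∀ t, IdentDistrib (a t) (a 0) μ μ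
  nonneg : ∀ t ω i l, 0 ≤ a t ω i l
  bounded : ∃ A : ℝ, ∀ t ω i l, a t ω i l ≤ A
  off_lifetimes : ∀ t ω i l, l ∉ Finset.Icc 1 N.L → a t ω i l = 0
  dest : ∀ t ω l, a t ω N.dest l = 0

/-- Mean arrival rates. -/
def arrivalRate (μ : Measure Ω) (a : ℕ → Ω → NodeVec V) (i : V) (l : ℕ) : ℝ :=
  ∫ ω, a 0 ω i l ∂μ

/-- The `ℓ¹` norm of the mean arrival rates. -/
def totalRate (μ : Measure Ω) (a : ℕ → Ω → NodeVec V) : ℝ :=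
  ∑ i, ∑ l ∈ Finset.Icc 1 N.L, |arrivalRate μ a i l|

/-- Mean arrival rate at `i` of lifetimes at least `l`. -/
def rateGE (μ : Measure Ω) (a : ℕ → Ω → NodeVec V) (i : V) (l : ℕ) : ℝ :=
  ∑ k ∈ Finset.Icc l N.L, arrivalRate μ a i k

/-- The long-term average `lim (1/T) ∑_{t < T} 𝔼 (z t)` exists and equals `m`. -/
def HasLongRunAvg (μ : Measure Ω) (z : ℕ → Ω → ℝ) (m : ℝ) : Prop :=
  Tendsto (fun T : ℕ => (1 / (T : ℝ)) * ∑ t ∈ Finset.range T, ∫ ω, z t ω ∂μ) atTop (𝓝 m)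

/-- The decisions of a (causal, possibly history dependent and randomized) policy: in each slot,
legitimate flow variables that depend on the information available in that slot. -/
structure IsPolicy (ℱ : Filtration ℕ mΩ) (x : ℕ → Ω → FlowVec V) : Prop where
  adapted : ∀ t, Measurable[ℱ t] (x t)
  isFlow : ∀ t ω, N.IsFlow (x t ω)

/-- Reliability constraint: the timely throughput is at least `γ ‖λ‖₁`. -/
def Reliable (μ : Measure Ω) (a : ℕ → Ω → NodeVec V) (γ : ℝ) (x : ℕ → Ω → FlowVec V) : Prop :=
  ∃ m, HasLongRunAvg μ (fun t ω => N.delivered (x t ω)) m ∧ γ * N.totalRate μ a ≤ m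

/-- Feasible policies of the actual network (average link capacities, availability of the packets
in the lifetime queues). -/
structure FeasibleActual (μ : Measure Ω) (ℱ : Filtration ℕ mΩ) (a : ℕ → Ω → NodeVec V)
    (q₀ : NodeVec V) (γ : ℝ) (x : ℕ → Ω → FlowVec V) : Prop where
  policy : N.IsPolicy ℱ x
  reliable : N.Reliable μ a γ x
  avgCapacity : ∀ i j, N.graph.Adj i j →
    ∃ m, HasLongRunAvg μ (fun t ω => N.linkFlow (x t ω) i j) m ∧ m ≤ N.cap i j
  availability : ∀ t ω i, ∀ l ∈ Finset.Icc 1 N.L,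
    N.outflow (x t ω) i l ≤ N.backlog q₀ (fun s => a s ω) (fun s => x s ω) t i l

/-- Feasible policies of the virtual network (peak link capacities, causality). -/
structure FeasibleVirtual (μ : Measure Ω) (ℱ : Filtration ℕ mΩ) (a : ℕ → Ω → NodeVec V)
    (γ : ℝ) (x : ℕ → Ω → FlowVec V) : Prop where
  policy : N.IsPolicy ℱ x
  reliable : N.Reliable μ a γ x
  peakCapacity : ∀ t ω i j, N.graph.Adj i j → N.linkFlow (x t ω) i j ≤ N.cap i j
  causality : ∀ i, ∀ l ∈ Finset.Icc 1 N.L, ∃ mo mi,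
    HasLongRunAvg μ (fun t ω => N.outflowGE (x t ω) i l) mo ∧
    HasLongRunAvg μ (fun t ω => N.inflowGE (x t ω) i (l + 1)) mi ∧
    mo ≤ mi + N.rateGE μ a i l

/-- The long-run average operational costs of the policies in a class `F`. -/
def attainedCosts (μ : Measure Ω) (F : (ℕ → Ω → FlowVec V) → Prop) : Set ℝ :=
  {c | ∃ x, F x ∧ HasLongRunAvg μ (fun t ω => N.opCost (x t ω)) c}

/-- The optimal value over a class `F` of policies, `⊤` if no policy of the class attains a
cost. -/
def optimalValue (μ : Measure Ω) (F : (ℕ → Ω → FlowVec V) → Prop) : EReal :=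
  sInf ((fun c : ℝ => (c : EReal)) '' N.attainedCosts μ F)

end

end PacketNetwork

/-! Both problems reduce to the same deterministic program: minimize the linear function `opCost`
over the set of fluid flows (`IsFluidFlow`), constant rates satisfying capacity, reliability and
causality. In each problem the set of attained costs is the image of this set, which is compact;
equality of the values and attainment follow.

From policies to fluid flows: the decisions are uniformly bounded, by the capacities in the virtual
network and, in the actual one, because packets expire within `L` slots (`sum_backlog_le`). The time
averages of the mean flows therefore have a limit point (`IsPolicy.exists_limit_flow`). Single
coordinates need not have a long-run average, but every average that a constraint or the objective
assumes to exist takes the same value at the limit point. In the actual network causality comes from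
telescoping the queue equations (`sum_outflowGE_le`).

From fluid flows to policies: the virtual network can use the fluid flow itself in every slot. In
the actual network each node forwards fixed fractions of its backlogs. Causality says precisely that
the stationary backlogs computed from the fluid flow cover its outflow, so the fractions sum to at
most one (`IsFluidFlow.exists_splitFlow_eq`). Mean backlogs then obey an affine recursion that feeds
lifetime `l` from lifetime `l + 1` only, so the initial state is forgotten and the mean flow equals
the fluid flow exactly from slot `L` on (`splitFlow_integral_splitBacklog`). -/

namespace PacketNetwork

variable {V : Type*} [Fintype V] (N : PacketNetwork V)
variable {Ω : Type*} {mΩ : MeasurableSpace Ω}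

/-! ### Linear functionals of flow vectors -/

/-- The linear functionals of a flow vector that depend on finitely many coordinates. -/
def coordSpan (V : Type*) : Submodule ℝ (FlowVec V → ℝ) :=
  Submodule.span ℝ (Set.range fun p : V × V × ℕ => fun x : FlowVec V => x p.1 p.2.1 p.2.2)

theorem coord_mem_coordSpan {V : Type*} (i j : V) (l : ℕ) :
    (fun x : FlowVec V => x i j l) ∈ coordSpan V :=
  Submodule.subset_span ⟨(i, j, l), rfl⟩

theorem sum_mem_coordSpan {V ι : Type*} (s : Finset ι) (f : ι → FlowVec V → ℝ)
    (h : ∀ k ∈ s, f k ∈ coordSpan V) : (fun x => ∑ k ∈ s, f k x) ∈ coordSpan V := by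
  have := Submodule.sum_mem _ h
  convert this using 1
  ext x
  simp

theorem outflow_mem_coordSpan (i : V) (l : ℕ) : (fun x => N.outflow x i l) ∈ coordSpan V :=
  sum_mem_coordSpan _ _ fun _ _ => coord_mem_coordSpan _ _ _

theorem inflow_mem_coordSpan (i : V) (l : ℕ) : (fun x => N.inflow x i l) ∈ coordSpan V :=
  sum_mem_coordSpan _ _ fun _ _ => coord_mem_coordSpan _ _ _

theorem outflowGE_mem_coordSpan (i : V) (l : ℕ) : (fun x => N.outflowGE x i l) ∈ coordSpan V :=
  sum_mem_coordSpan _ _ fun _ _ => N.outflow_mem_coordSpan _ _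

theorem inflowGE_mem_coordSpan (i : V) (l : ℕ) : (fun x => N.inflowGE x i l) ∈ coordSpan V :=
  sum_mem_coordSpan _ _ fun _ _ => N.inflow_mem_coordSpan _ _

omit [Fintype V] in
theorem linkFlow_mem_coordSpan (i j : V) : (fun x => N.linkFlow x i j) ∈ coordSpan V :=
  sum_mem_coordSpan _ _ fun _ _ => coord_mem_coordSpan _ _ _

theorem delivered_mem_coordSpan : (fun x => N.delivered x) ∈ coordSpan V :=
  sum_mem_coordSpan _ _ fun _ _ => N.inflow_mem_coordSpan _ _

theorem opCost_mem_coordSpan : (fun x => N.opCost x) ∈ coordSpan V :=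
  sum_mem_coordSpan _ _ fun i _ => sum_mem_coordSpan _ _ fun j _ =>
    Submodule.smul_mem _ (N.cost i j) (N.linkFlow_mem_coordSpan i j)

theorem continuous_of_mem_coordSpan {V : Type*} {φ : FlowVec V → ℝ} (hφ : φ ∈ coordSpan V) :
    Continuous φ := by
  induction hφ using Submodule.span_induction with
  | mem x h => obtain ⟨p, rfl⟩ := h; fun_prop
  | zero => exact continuous_const
  | add x y _ _ hx hy => exact hx.add hy
  | smul c x _ hx => exact hx.const_smul c

/-- Together with `average_of_mem_coordSpan`, this lets expectations and time averages pass inside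
every quantity of the problem, so that only coordinatewise mean rates matter. -/
theorem integrable_and_integral_of_mem_coordSpan {V : Type*} {φ : FlowVec V → ℝ}
    (hφ : φ ∈ coordSpan V) {μ : Measure Ω} {x : Ω → FlowVec V}
    (hx : ∀ i j l, Integrable (fun ω => x ω i j l) μ) :
    Integrable (fun ω => φ (x ω)) μ ∧
      ∫ ω, φ (x ω) ∂μ = φ (fun i j l => ∫ ω, x ω i j l ∂μ) := by
  induction hφ using Submodule.span_induction with
  | mem f h => obtain ⟨p, rfl⟩ := h; exact ⟨hx _ _ _, rfl⟩
  | zero => simp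
  | add f g _ _ hf hg =>
    refine ⟨hf.1.add hg.1, ?_⟩
    simp only [Pi.add_apply]
    rw [integral_add hf.1 hg.1, hf.2, hg.2]
  | smul c f _ hf =>
    refine ⟨hf.1.const_mul c, ?_⟩
    simp only [Pi.smul_apply, smul_eq_mul]
    rw [integral_const_mul, hf.2]

theorem average_of_mem_coordSpan {V : Type*} {φ : FlowVec V → ℝ} (hφ : φ ∈ coordSpan V)
    (u : ℕ → FlowVec V) (T : ℕ) :
    (1 / (T : ℝ)) * ∑ t ∈ Finset.range T, φ (u t) =
      φ (fun i j l => (1 / (T : ℝ)) * ∑ t ∈ Finset.range T, u t i j l) := by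
  induction hφ using Submodule.span_induction with
  | mem f h => obtain ⟨p, rfl⟩ := h; rfl
  | zero => simp
  | add f g _ _ hf hg =>
    simp only [Pi.add_apply, Finset.sum_add_distrib, mul_add, hf, hg]
  | smul c f _ hf =>
    simp only [Pi.smul_apply, smul_eq_mul, ← Finset.mul_sum, ← hf]
    ring

/-! ### Fluid flows -/

/-- Flow rates that satisfy the capacity, reliability and causality constraints of the virtual
network with arrival rates `r` and required throughput `θ`. -/
structure IsFluidFlow (r : NodeVec V) (θ : ℝ) (y : FlowVec V) : Prop where
  isFlow : N.IsFlow y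
  reliable : θ ≤ N.delivered y
  capacity : ∀ i j, N.graph.Adj i j → N.linkFlow y i j ≤ N.cap i j
  causality : ∀ i, ∀ l ∈ Finset.Icc 1 N.L,
    N.outflowGE y i l ≤ N.inflowGE y i (l + 1) + ∑ k ∈ Finset.Icc l N.L, r i k

variable {N}

omit [Fintype V] in
theorem IsFlow.le_linkFlow {y : FlowVec V} (h : N.IsFlow y) (i j : V) (l : ℕ) :
    y i j l ≤ N.linkFlow y i j := by
  by_cases hl : l ∈ Finset.Icc 1 N.L
  · exact Finset.single_le_sum (f := fun l => y i j l) (fun k _ => h.nonneg i j k) hl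
  · rw [h.off_lifetimes i j l hl]
    exact Finset.sum_nonneg fun k _ => h.nonneg i j k

theorem IsFlow.outflow_nonneg {y : FlowVec V} (h : N.IsFlow y) (i : V) (l : ℕ) :
    0 ≤ N.outflow y i l := Finset.sum_nonneg fun _ _ => h.nonneg _ _ _

theorem IsFlow.inflow_nonneg {y : FlowVec V} (h : N.IsFlow y) (i : V) (l : ℕ) :
    0 ≤ N.inflow y i l := Finset.sum_nonneg fun _ _ => h.nonneg _ _ _

theorem IsFlow.le_outflow {y : FlowVec V} (h : N.IsFlow y) (i j : V) (l : ℕ) :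
    y i j l ≤ N.outflow y i l := by
  by_cases hj : N.graph.Adj i j
  · exact Finset.single_le_sum (f := fun j => y i j l) (fun k _ => h.nonneg i k l)
      (by simpa [outNbrs] using hj)
  · rw [h.off_links i j l hj]
    exact h.outflow_nonneg i l

theorem IsFlow.outflow_dest {y : FlowVec V} (h : N.IsFlow y) (l : ℕ) :
    N.outflow y N.dest l = 0 := Finset.sum_eq_zero fun _ _ => h.dest_out _ _

variable (N)

theorem sum_inflow_eq_sum_outflow (y : FlowVec V) (l : ℕ) :
    ∑ i, N.inflow y i l = ∑ i, N.outflow y i l := by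
  unfold inflow outflow
  refine Finset.sum_comm' fun i j => ?_
  simp [inNbrs, outNbrs]

omit [Fintype V] in
theorem isClosed_setOf_isFlow : IsClosed {y : FlowVec V | N.IsFlow y} := by
  have : {y : FlowVec V | N.IsFlow y} =
      {y | ∀ i j l, 0 ≤ y i j l} ∩ {y | ∀ i j l, ¬ N.graph.Adj i j → y i j l = 0} ∩
      {y | ∀ i j l, l ∉ Finset.Icc 1 N.L → y i j l = 0} ∩ {y | ∀ j l, y N.dest j l = 0} ∩
      {y | ∀ i j, j ≠ N.dest → y i j 1 = 0} := by
    ext y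
    exact ⟨fun h => ⟨⟨⟨⟨h.1, h.2⟩, h.3⟩, h.4⟩, h.5⟩,
      fun h => ⟨h.1.1.1.1, h.1.1.1.2, h.1.1.2, h.1.2, h.2⟩⟩
  rw [this]
  simp only [Set.ofPred_forall]
  refine ((((?_ : IsClosed _).inter ?_).inter ?_).inter ?_).inter ?_ <;>
  · repeat' refine isClosed_iInter fun _ => ?_
    first
    | exact isClosed_le (by fun_prop) (by fun_prop)
    | exact isClosed_eq (by fun_prop) (by fun_prop)

theorem isCompact_setOf_isFluidFlow (r : NodeVec V) (θ : ℝ) :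
    IsCompact {y : FlowVec V | N.IsFluidFlow r θ y} := by
  -- Tychonoff handles the infinitely many lifetime coordinates. The maximum with `0` keeps the zero
  -- flow of non-links in the box, where `cap` is arbitrary and possibly negative.
  have hK : IsCompact (Set.univ.pi fun i : V => Set.univ.pi fun j : V =>
      Set.univ.pi fun _ : ℕ => Set.Icc (0 : ℝ) (max 0 (N.cap i j))) :=
    isCompact_univ_pi fun i => isCompact_univ_pi fun j => isCompact_univ_pi fun l => isCompact_Icc
  refine hK.of_isClosed_subset ?_ ?_
  · have : {y : FlowVec V | N.IsFluidFlow r θ y} =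
        {y | N.IsFlow y} ∩ {y | θ ≤ N.delivered y} ∩
        {y | ∀ i j, N.graph.Adj i j → N.linkFlow y i j ≤ N.cap i j} ∩
        {y | ∀ i, ∀ l ∈ Finset.Icc 1 N.L, N.outflowGE y i l ≤
          N.inflowGE y i (l + 1) + ∑ k ∈ Finset.Icc l N.L, r i k} := by
      ext y
      exact ⟨fun h => ⟨⟨⟨h.1, h.2⟩, h.3⟩, h.4⟩, fun h => ⟨h.1.1.1, h.1.1.2, h.1.2, h.2⟩⟩
    rw [this]
    refine (((N.isClosed_setOf_isFlow).inter
      (isClosed_le continuous_const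
        (continuous_of_mem_coordSpan N.delivered_mem_coordSpan))).inter ?_).inter ?_
    · simp only [Set.ofPred_forall]
      exact isClosed_iInter fun i => isClosed_iInter fun j => isClosed_iInter fun _ =>
        isClosed_le (continuous_of_mem_coordSpan (N.linkFlow_mem_coordSpan i j)) continuous_const
    · simp only [Set.ofPred_forall]
      exact isClosed_iInter fun i => isClosed_iInter fun l => isClosed_iInter fun _ =>
        isClosed_le (continuous_of_mem_coordSpan (N.outflowGE_mem_coordSpan i l))
          ((continuous_of_mem_coordSpan (N.inflowGE_mem_coordSpan i (l + 1))).add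
            continuous_const)
  · intro y hy i _ j _ l _
    refine ⟨hy.isFlow.nonneg i j l, ?_⟩
    by_cases hij : N.graph.Adj i j
    · exact (hy.isFlow.le_linkFlow i j l).trans ((hy.capacity i j hij).trans (le_max_right _ _))
    · rw [hy.isFlow.off_links i j l hij]
      exact le_max_left _ _

/-! ### Long-run averages of bounded policies -/

variable {N}

omit [Fintype V] in
theorem IsPolicy.integrable {μ : Measure Ω} [IsFiniteMeasure μ] {ℱ : Filtration ℕ mΩ}
    {x : ℕ → Ω → FlowVec V} (hx : N.IsPolicy ℱ x) {B : ℝ} (hB : ∀ t ω i j l, x t ω i j l ≤ B)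
    (t : ℕ) (i j : V) (l : ℕ) : Integrable (fun ω => x t ω i j l) μ := by
  have hm : Measurable (x t) := (hx.adapted t).mono (ℱ.le t) le_rfl
  have hm' : Measurable (fun ω => x t ω i j l) := by fun_prop
  refine Integrable.of_bound hm'.aestronglyMeasurable B (ae_of_all _ fun ω => ?_)
  rw [Real.norm_of_nonneg ((hx.isFlow t ω).nonneg i j l)]
  exact hB t ω i j l

omit [Fintype V] in
/-- A bounded policy has a limit point of its time averages: a flow along whose subsequence all
long-run averages of linear functionals converge. -/
theorem IsPolicy.exists_limit_flow {μ : Measure Ω} [IsProbabilityMeasure μ] {ℱ : Filtration ℕ mΩ}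
    {x : ℕ → Ω → FlowVec V} (hx : N.IsPolicy ℱ x) {B : ℝ} (hB : ∀ t ω i j l, x t ω i j l ≤ B) :
    ∃ y : FlowVec V, N.IsFlow y ∧ ∃ f : Filter ℕ, f.NeBot ∧ f ≤ atTop ∧
      ∀ φ ∈ coordSpan V, Tendsto (fun T : ℕ => (1 / (T : ℝ)) *
        ∑ t ∈ Finset.range T, ∫ ω, φ (x t ω) ∂μ) f (𝓝 (φ y)) := by
  let u : ℕ → FlowVec V := fun t i j l => ∫ ω, x t ω i j l ∂μ
  let v : ℕ → FlowVec V := fun T i j l => (1 / (T : ℝ)) * ∑ t ∈ Finset.range T, u t i j l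
  have hu0 : ∀ t i j l, 0 ≤ u t i j l := fun t i j l =>
    integral_nonneg fun ω => (hx.isFlow t ω).nonneg i j l
  have huB : ∀ t i j l, u t i j l ≤ B := fun t i j l => by
    have := integral_mono (μ := μ) (hx.integrable hB t i j l) (integrable_const B)
      (fun ω => hB t ω i j l)
    simpa using this
  have hB0 : ∀ i : V, 0 ≤ B := fun i => (hu0 0 i i 0).trans (huB 0 i i 0)
  have hvflow : ∀ T, N.IsFlow (v T) := fun T => by
    have hz : ∀ i j l, (∀ t ω, x t ω i j l = 0) → v T i j l = 0 := fun i j l h => by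
      simp [v, u, h]
    exact
      { nonneg := fun i j l => mul_nonneg (by positivity) (Finset.sum_nonneg fun t _ => hu0 t i j l)
        off_links := fun i j l h => hz _ _ _ fun t ω => (hx.isFlow t ω).off_links i j l h
        off_lifetimes := fun i j l h => hz _ _ _ fun t ω => (hx.isFlow t ω).off_lifetimes i j l h
        dest_out := fun j l => hz _ _ _ fun t ω => (hx.isFlow t ω).dest_out j l
        last_slot := fun i j h => hz _ _ _ fun t ω => (hx.isFlow t ω).last_slot i j h }
  have hK : IsCompact (Set.univ.pi fun _ : V => Set.univ.pi fun _ : V =>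
      Set.univ.pi fun _ : ℕ => Set.Icc (0 : ℝ) B) :=
    isCompact_univ_pi fun i => isCompact_univ_pi fun j => isCompact_univ_pi fun l => isCompact_Icc
  have hvK : ∀ T, v T ∈ (Set.univ.pi fun _ : V => Set.univ.pi fun _ : V =>
      Set.univ.pi fun _ : ℕ => Set.Icc (0 : ℝ) B) := by
    intro T i _ j _ l _
    refine ⟨(hvflow T).nonneg i j l, ?_⟩
    -- For `T = 0` the average is the zero flow, since `1 / 0 = 0`.
    rcases Nat.eq_zero_or_pos T with rfl | hT
    · simpa [v] using hB0 i
    · have hT' : (0 : ℝ) < T := by exact_mod_cast hT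
      have : ∑ t ∈ Finset.range T, u t i j l ≤ T * B := by
        simpa using Finset.sum_le_card_nsmul (Finset.range T) (fun t => u t i j l) B
          (fun t _ => huB t i j l)
      simp only [v]
      rw [one_div, inv_mul_le_iff₀ hT']
      exact this
  -- An ultrafilter finer than `atTop` plays the role of the convergent subsequence: its image under
  -- `v` lies in a compact box, hence converges.
  let F : Ultrafilter ℕ := Ultrafilter.of atTop
  obtain ⟨y, -, hy⟩ := hK.ultrafilter_le_nhds (F.map v)
    (le_principal_iff.2 (Filter.mem_map.2 (Filter.univ_mem' hvK)))
  have hy' : Tendsto v F (𝓝 y) := hy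
  refine ⟨y, ?_, F, F.neBot', Ultrafilter.of_le _, fun φ hφ => ?_⟩
  · exact (N.isClosed_setOf_isFlow).mem_of_tendsto hy' (Eventually.of_forall hvflow)
  · have := ((continuous_of_mem_coordSpan hφ).tendsto y).comp hy'
    refine this.congr fun T => ?_
    rw [Function.comp_apply, ← average_of_mem_coordSpan hφ u T]
    refine congrArg _ (Finset.sum_congr rfl fun t _ => ?_)
    exact (integrable_and_integral_of_mem_coordSpan hφ (hx.integrable hB t)).2.symm

/-! ### The virtual network -/

theorem FeasibleVirtual.exists_isFluidFlow {μ : Measure Ω} [IsProbabilityMeasure μ]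
    {ℱ : Filtration ℕ mΩ} {a : ℕ → Ω → NodeVec V} {γ : ℝ} {x : ℕ → Ω → FlowVec V}
    (hx : N.FeasibleVirtual μ ℱ a γ x) :
    ∃ y, N.IsFluidFlow (arrivalRate μ a) (γ * N.totalRate μ a) y ∧
      ∀ c, HasLongRunAvg μ (fun t ω => N.opCost (x t ω)) c → N.opCost y = c := by
  have hB : ∀ t ω i j l, x t ω i j l ≤ ∑ i, ∑ j, |N.cap i j| := by
    intro t ω i j l
    have hS : |N.cap i j| ≤ ∑ i, ∑ j, |N.cap i j| :=
      (Finset.single_le_sum (f := fun j => |N.cap i j|) (fun _ _ => abs_nonneg _)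
        (Finset.mem_univ j)).trans
      (Finset.single_le_sum (f := fun i => ∑ j, |N.cap i j|)
        (fun _ _ => Finset.sum_nonneg fun _ _ => abs_nonneg _) (Finset.mem_univ i))
    have hf := hx.policy.isFlow t ω
    by_cases hij : N.graph.Adj i j
    · exact (hf.le_linkFlow i j l).trans
        ((hx.peakCapacity t ω i j hij).trans ((le_abs_self _).trans hS))
    · rw [hf.off_links i j l hij]
      exact (abs_nonneg _).trans hS
  obtain ⟨y, hy, f, hf, hle, hlim⟩ := hx.policy.exists_limit_flow (μ := μ) hB
  -- An average that exists along `atTop` has the same limit along the finer filter `f`.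
  have key : ∀ φ ∈ coordSpan V, ∀ m, HasLongRunAvg μ (fun t ω => φ (x t ω)) m → φ y = m :=
    fun φ hφ m hm => tendsto_nhds_unique (hlim φ hφ) (hm.mono_left hle)
  refine ⟨y, ⟨hy, ?_, fun i j hij => ?_, fun i l hl => ?_⟩,
    fun c hc => key _ N.opCost_mem_coordSpan c hc⟩
  · obtain ⟨m, hm, hγ⟩ := hx.reliable
    rwa [key _ N.delivered_mem_coordSpan m hm]
  -- No average link flow is assumed to exist here; the peak bound holds in every slot, so it holds
  -- for all finite averages and survives in the limit.
  · refine le_of_tendsto (hlim _ (N.linkFlow_mem_coordSpan i j))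
      ((eventually_gt_atTop 0).filter_mono hle |>.mono fun T hT => ?_)
    have hT' : (0 : ℝ) < T := by exact_mod_cast hT
    rw [one_div, inv_mul_le_iff₀ hT']
    have := Finset.sum_le_card_nsmul (Finset.range T)
      (fun t => ∫ ω, N.linkFlow (x t ω) i j ∂μ) (N.cap i j) (fun t _ => by
        have := integral_mono (μ := μ) (integrable_and_integral_of_mem_coordSpan
          (N.linkFlow_mem_coordSpan i j) (hx.policy.integrable hB t)).1
          (integrable_const (N.cap i j)) (fun ω => hx.peakCapacity t ω i j hij)
        simpa using this)
    simpa using this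
  · obtain ⟨mo, mi, ho, hi, h⟩ := hx.causality i l hl
    rw [key _ (N.outflowGE_mem_coordSpan i l) mo ho, key _ (N.inflowGE_mem_coordSpan i (l + 1)) mi hi]
    exact h

-- By Cesàro, a transient does not affect the long-run average; this disposes of the first `L` slots
-- of proportional routing.
omit [Fintype V] in
theorem hasLongRunAvg_of_eventually_eq {μ : Measure Ω} {z : ℕ → Ω → ℝ} {m : ℝ}
    (h : ∀ᶠ t in atTop, ∫ ω, z t ω ∂μ = m) : HasLongRunAvg μ z m := by
  have : Tendsto (fun t => ∫ ω, z t ω ∂μ) atTop (𝓝 m) :=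
    tendsto_const_nhds.congr' (h.mono fun _ ht => ht.symm)
  simpa [HasLongRunAvg] using this.cesaro

theorem IsFluidFlow.exists_feasibleVirtual {μ : Measure Ω} [IsProbabilityMeasure μ]
    (ℱ : Filtration ℕ mΩ) {a : ℕ → Ω → NodeVec V} {γ : ℝ} {y : FlowVec V}
    (hy : N.IsFluidFlow (arrivalRate μ a) (γ * N.totalRate μ a) y) :
    ∃ x, N.FeasibleVirtual μ ℱ a γ x ∧
      HasLongRunAvg μ (fun t ω => N.opCost (x t ω)) (N.opCost y) := by
  have hc : ∀ φ : FlowVec V → ℝ, HasLongRunAvg μ (fun (_ : ℕ) (_ : Ω) => φ y) (φ y) := fun φ =>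
    hasLongRunAvg_of_eventually_eq (Eventually.of_forall fun t => by simp)
  exact ⟨fun _ _ => y,
    { policy := ⟨fun t => measurable_const, fun _ _ => hy.isFlow⟩
      reliable := ⟨_, hc _, hy.reliable⟩
      peakCapacity := fun _ _ => hy.capacity
      causality := fun i l hl => ⟨_, _, hc (fun y => N.outflowGE y i l),
        hc (fun y => N.inflowGE y i (l + 1)), hy.causality i l hl⟩ },
    hc _⟩

/-! ### Arrivals -/

omit [Fintype V] in
theorem IsArrivalStream.integrable {μ : Measure Ω} [IsFiniteMeasure μ] {ℱ : Filtration ℕ mΩ}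
    {a : ℕ → Ω → NodeVec V} (ha : N.IsArrivalStream μ ℱ a) (t : ℕ) (i : V) (l : ℕ) :
    Integrable (fun ω => a t ω i l) μ := by
  obtain ⟨A, hA⟩ := ha.bounded
  have hm : Measurable (a t) := (ha.adapted t).mono (ℱ.le _) le_rfl
  have hm' : Measurable (fun ω => a t ω i l) := by fun_prop
  refine Integrable.of_bound hm'.aestronglyMeasurable A (ae_of_all _ fun ω => ?_)
  rw [Real.norm_of_nonneg (ha.nonneg t ω i l)]
  exact hA t ω i l

omit [Fintype V] in
theorem IsArrivalStream.integral_eq {μ : Measure Ω} {ℱ : Filtration ℕ mΩ}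
    {a : ℕ → Ω → NodeVec V} (ha : N.IsArrivalStream μ ℱ a) (t : ℕ) (i : V) (l : ℕ) :
    ∫ ω, a t ω i l ∂μ = arrivalRate μ a i l :=
  ((ha.identDistrib t).comp (u := fun q : NodeVec V => q i l) (by fun_prop)).integral_eq

/-! ### From the actual network to fluid flows -/

theorem backlog_eq_zero (q₀ : NodeVec V) (a : ℕ → NodeVec V) (x : ℕ → FlowVec V) (t : ℕ) (i : V)
    (l : ℕ) (h : ¬ (i ≠ N.dest ∧ l ∈ Finset.Icc 1 N.L)) : N.backlog q₀ a x t i l = 0 := by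
  cases t <;> simp only [backlog, if_neg h]

theorem backlog_succ (q₀ : NodeVec V) (a : ℕ → NodeVec V) (x : ℕ → FlowVec V) (t : ℕ) (i : V)
    (l : ℕ) (hi : i ≠ N.dest) (hl : l ∈ Finset.Icc 1 N.L) :
    N.backlog q₀ a x (t + 1) i l = N.backlog q₀ a x t i (l + 1) - N.outflow (x t) i (l + 1) +
      N.inflow (x t) i (l + 1) + a t i l := by
  simp only [backlog, if_pos (And.intro hi hl)]

/-- Backlogs stay bounded, as packets live for at most `L` slots. -/
theorem sum_backlog_le {q₀ : NodeVec V} (hq₀ : ∀ i l, 0 ≤ q₀ i l) {a : ℕ → NodeVec V} {A : ℝ}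
    (ha0 : ∀ t i l, 0 ≤ a t i l) (hA : ∀ t i l, a t i l ≤ A)
    {x : ℕ → FlowVec V} (hx : ∀ t, N.IsFlow (x t)) (t l : ℕ) :
    ∑ i, N.backlog q₀ a x t i l ≤ (∑ i, ∑ k ∈ Finset.Icc 1 N.L, q₀ i k) +
      ((N.L + 1 - l : ℕ) : ℝ) * (Fintype.card V * A) := by
  have hA0 : 0 ≤ A := (ha0 0 N.dest 0).trans (hA 0 N.dest 0)
  have hq : 0 ≤ ∑ i, ∑ k ∈ Finset.Icc 1 N.L, q₀ i k :=
    Finset.sum_nonneg fun i _ => Finset.sum_nonneg fun k _ => hq₀ i k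
  induction t generalizing l with
  | zero =>
    refine le_add_of_le_of_nonneg (Finset.sum_le_sum fun i _ => ?_) (by positivity)
    simp only [backlog]
    split_ifs with h
    · exact Finset.single_le_sum (f := fun k => q₀ i k) (fun k _ => hq₀ i k) h.2
    · exact Finset.sum_nonneg fun k _ => hq₀ i k
  | succ t ih =>
    by_cases hl : l ∈ Finset.Icc 1 N.L
    · have hstep : ∀ i, N.backlog q₀ a x (t + 1) i l ≤ N.backlog q₀ a x t i (l + 1) -
          N.outflow (x t) i (l + 1) + N.inflow (x t) i (l + 1) + A := by
        intro i
        by_cases hi : i = N.dest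
        · rw [backlog_eq_zero _ _ _ _ _ _ (by simp [hi]),
            backlog_eq_zero _ _ _ _ _ _ (by simp [hi]), hi, (hx t).outflow_dest]
          have := (hx t).inflow_nonneg N.dest (l + 1)
          linarith
        · rw [backlog_succ _ _ _ _ _ _ hi hl]
          linarith [hA t i l]
      -- Summed over all nodes, transfers between nodes cancel. What remains is the total backlog
      -- one lifetime higher plus at most `A` new packets per node, hence one factor `Fintype.card V
      -- * A` for each lifetime from `l` to `L`.
      have h1 := Finset.sum_le_sum fun i (_ : i ∈ Finset.univ) => hstep i
      simp only [Finset.sum_add_distrib, Finset.sum_sub_distrib, sum_inflow_eq_sum_outflow,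
        Finset.sum_const, Finset.card_univ, nsmul_eq_mul] at h1
      have h2 := ih (l + 1)
      have h3 : N.L + 1 - l = (N.L + 1 - (l + 1)) + 1 := by
        have := Finset.mem_Icc.1 hl
        omega
      rw [h3, Nat.cast_add_one, add_one_mul]
      linarith
    · rw [Finset.sum_eq_zero fun i _ => backlog_eq_zero _ _ _ _ _ _ fun h => hl h.2]
      positivity

theorem sum_Icc_succ_shift {L : ℕ} (g : ℕ → ℝ) (hg : g (L + 1) = 0) (l : ℕ) :
    ∑ k ∈ Finset.Icc l L, g (k + 1) = ∑ k ∈ Finset.Icc (l + 1) L, g k := by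
  rcases Nat.lt_or_ge L l with h | h
  · rw [Finset.Icc_eq_empty (by omega), Finset.Icc_eq_empty (by omega)]
    simp
  · have h1 : ∑ k ∈ Finset.Icc l L, g (k + 1) = ∑ k ∈ Finset.Icc (l + 1) (L + 1), g k := by
      rw [← Finset.map_add_right_Icc, Finset.sum_map]
      rfl
    rw [h1, Finset.sum_Icc_succ_top (by omega), hg, add_zero]

theorem sum_Icc_eq_add {L : ℕ} (g : ℕ → ℝ) {l : ℕ} (h : l ≤ L) :
    ∑ k ∈ Finset.Icc l L, g k = g l + ∑ k ∈ Finset.Icc (l + 1) L, g k := by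
  rw [← Finset.add_sum_Ioc_eq_sum_Icc h, Finset.Icc_add_one_left_eq_Ioc]

/-- Pathwise causality: up to the initial backlog, the packets of lifetime at least `l` that leave
a node have entered it with lifetime at least `l + 1` or are exogenous arrivals. -/
theorem sum_outflowGE_le {q₀ : NodeVec V} {a : ℕ → NodeVec V} (ha0 : ∀ t i l, 0 ≤ a t i l)
    {x : ℕ → FlowVec V} (hx : ∀ t, N.IsFlow (x t))
    (hav : ∀ t i, ∀ l ∈ Finset.Icc 1 N.L, N.outflow (x t) i l ≤ N.backlog q₀ a x t i l)
    (i : V) (l : ℕ) (hl : l ∈ Finset.Icc 1 N.L) (T : ℕ) :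
    ∑ t ∈ Finset.range T, N.outflowGE (x t) i l ≤
      ∑ t ∈ Finset.range T, N.inflowGE (x t) i (l + 1) +
      ∑ t ∈ Finset.range T, ∑ k ∈ Finset.Icc l N.L, a t i k +
      ∑ k ∈ Finset.Icc l N.L, N.backlog q₀ a x 0 i k := by
  have hl' := Finset.mem_Icc.1 hl
  have hsub : ∀ k ∈ Finset.Icc l N.L, k ∈ Finset.Icc 1 N.L := fun k hk => by
    rw [Finset.mem_Icc] at hk ⊢; omega
  -- Keeping the final backlog on the left makes the induction telescope. It can be dropped at the
  -- end because availability forces it to be non-negative.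
  suffices h : ∑ t ∈ Finset.range T, N.outflowGE (x t) i l +
      ∑ k ∈ Finset.Icc l N.L, N.backlog q₀ a x T i k ≤
      ∑ t ∈ Finset.range T, N.inflowGE (x t) i (l + 1) +
      ∑ t ∈ Finset.range T, ∑ k ∈ Finset.Icc l N.L, a t i k +
      ∑ k ∈ Finset.Icc l N.L, N.backlog q₀ a x 0 i k by
    have : 0 ≤ ∑ k ∈ Finset.Icc l N.L, N.backlog q₀ a x T i k := Finset.sum_nonneg fun k hk =>
      ((hx T).outflow_nonneg i k).trans (hav T i k (hsub k hk))
    linarith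
  induction T with
  | zero => simp
  | succ T ih =>
    simp only [Finset.sum_range_succ]
    suffices h : N.outflowGE (x T) i l + ∑ k ∈ Finset.Icc l N.L, N.backlog q₀ a x (T + 1) i k ≤
        N.inflowGE (x T) i (l + 1) + ∑ k ∈ Finset.Icc l N.L, a T i k +
        ∑ k ∈ Finset.Icc l N.L, N.backlog q₀ a x T i k by
      linarith
    by_cases hi : i = N.dest
    · have h1 : ∀ t, ∑ k ∈ Finset.Icc l N.L, N.backlog q₀ a x t i k = 0 := fun t =>
        Finset.sum_eq_zero fun k _ => backlog_eq_zero _ _ _ _ _ _ (by simp [hi])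
      have h2 : N.outflowGE (x T) i l = 0 :=
        Finset.sum_eq_zero fun k _ => by rw [hi, (hx T).outflow_dest]
      have h3 : 0 ≤ N.inflowGE (x T) i (l + 1) :=
        Finset.sum_nonneg fun k _ => (hx T).inflow_nonneg i k
      have h4 : 0 ≤ ∑ k ∈ Finset.Icc l N.L, a T i k := Finset.sum_nonneg fun k _ => ha0 T i k
      rw [h1, h1, h2]
      linarith
    · have htop : N.L + 1 ∉ Finset.Icc 1 N.L := by simp
      rw [Finset.sum_congr rfl fun k hk => backlog_succ q₀ a x T i k hi (hsub k hk)]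
      simp only [Finset.sum_add_distrib, Finset.sum_sub_distrib]
      -- Aging shifts the lifetime index by one, and the boundary terms at `L + 1` vanish. After
      -- cancellation the claim is availability at the single lifetime `l`.
      rw [sum_Icc_succ_shift (fun k => N.backlog q₀ a x T i k)
          (backlog_eq_zero _ _ _ _ _ _ fun h => htop h.2),
        sum_Icc_succ_shift (fun k => N.outflow (x T) i k)
          (Finset.sum_eq_zero fun j _ => (hx T).off_lifetimes _ _ _ htop),
        sum_Icc_succ_shift (fun k => N.inflow (x T) i k)
          (Finset.sum_eq_zero fun j _ => (hx T).off_lifetimes _ _ _ htop),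
        sum_Icc_eq_add (fun k => N.backlog q₀ a x T i k) hl'.2]
      unfold outflowGE inflowGE
      rw [sum_Icc_eq_add (fun k => N.outflow (x T) i k) hl'.2]
      linarith [hav T i l hl]

theorem FeasibleActual.exists_isFluidFlow {μ : Measure Ω} [IsProbabilityMeasure μ]
    {ℱ : Filtration ℕ mΩ} {a : ℕ → Ω → NodeVec V} (ha : N.IsArrivalStream μ ℱ a)
    {q₀ : NodeVec V} (hq₀ : ∀ i l, 0 ≤ q₀ i l) {γ : ℝ} {x : ℕ → Ω → FlowVec V}
    (hx : N.FeasibleActual μ ℱ a q₀ γ x) :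
    ∃ y, N.IsFluidFlow (arrivalRate μ a) (γ * N.totalRate μ a) y ∧
      ∀ c, HasLongRunAvg μ (fun t ω => N.opCost (x t ω)) c → N.opCost y = c := by
  obtain ⟨A, hA⟩ := ha.bounded
  have hA0 : ∀ ω : Ω, 0 ≤ A := fun ω => (ha.nonneg 0 ω N.dest 0).trans (hA 0 ω N.dest 0)
  have hnn : ∀ t ω i l, 0 ≤ N.backlog q₀ (fun s => a s ω) (fun s => x s ω) t i l := by
    intro t ω i l
    by_cases hl : l ∈ Finset.Icc 1 N.L
    · exact ((hx.policy.isFlow t ω).outflow_nonneg i l).trans (hx.availability t ω i l hl)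
    · rw [backlog_eq_zero _ _ _ _ _ _ fun h => hl h.2]
  -- Capacities hold only on average, so they bound no single slot; instead a flow is at most the
  -- backlog it draws from.
  have hB : ∀ t ω i j l, x t ω i j l ≤ (∑ i, ∑ k ∈ Finset.Icc 1 N.L, q₀ i k) +
      N.L * (Fintype.card V * A) := by
    intro t ω i j l
    have hf := hx.policy.isFlow t ω
    have := hA0 ω
    by_cases hl : l ∈ Finset.Icc 1 N.L
    · refine (hf.le_outflow i j l).trans ((hx.availability t ω i l hl).trans
        ((Finset.single_le_sum (f := fun i => N.backlog q₀ (fun s => a s ω) (fun s => x s ω) t i l)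
          (fun i _ => hnn t ω i l) (Finset.mem_univ i)).trans
        ((sum_backlog_le hq₀ (fun t => ha.nonneg t ω) (fun t => hA t ω)
          (fun t => hx.policy.isFlow t ω) t l).trans ?_)))
      have h1 := Finset.mem_Icc.1 hl
      have h2 : ((N.L + 1 - l : ℕ) : ℝ) ≤ N.L := by exact_mod_cast (by omega)
      gcongr
    · rw [hf.off_lifetimes i j l hl]
      exact add_nonneg (Finset.sum_nonneg fun i _ => Finset.sum_nonneg fun k _ => hq₀ i k)
        (by positivity)
  obtain ⟨y, hy, f, hf, hle, hlim⟩ := hx.policy.exists_limit_flow (μ := μ) hB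
  have key : ∀ φ ∈ coordSpan V, ∀ m, HasLongRunAvg μ (fun t ω => φ (x t ω)) m → φ y = m :=
    fun φ hφ m hm => tendsto_nhds_unique (hlim φ hφ) (hm.mono_left hle)
  refine ⟨y, ⟨hy, ?_, fun i j hij => ?_, fun i l hl => ?_⟩,
    fun c hc => key _ N.opCost_mem_coordSpan c hc⟩
  · obtain ⟨m, hm, hγ⟩ := hx.reliable
    rwa [key _ N.delivered_mem_coordSpan m hm]
  · obtain ⟨m, hm, hc⟩ := hx.avgCapacity i j hij
    rwa [key _ (N.linkFlow_mem_coordSpan i j) m hm]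
  · have hint : ∀ φ ∈ coordSpan V, ∀ t, Integrable (fun ω => φ (x t ω)) μ := fun φ hφ t =>
      (integrable_and_integral_of_mem_coordSpan hφ (hx.policy.integrable hB t)).1
    have hio := hint _ (N.outflowGE_mem_coordSpan i l)
    have hii := hint _ (N.inflowGE_mem_coordSpan i (l + 1))
    have hia : ∀ t, Integrable (fun ω => ∑ k ∈ Finset.Icc l N.L, a t ω i k) μ := fun t =>
      integrable_finsetSum _ fun k _ => ha.integrable t i k
    -- The backlog of slot `0` depends on neither arrivals nor decisions, so zeros serve as
    -- placeholders and `b` is deterministic. Its contribution `b / T` vanishes in the limit.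
    let b : ℝ := ∑ k ∈ Finset.Icc l N.L, N.backlog q₀ 0 0 0 i k
    let ρ : ℝ := ∑ k ∈ Finset.Icc l N.L, arrivalRate μ a i k
    have hsum : ∀ T : ℕ, ∑ t ∈ Finset.range T, ∫ ω, N.outflowGE (x t ω) i l ∂μ ≤
        ∑ t ∈ Finset.range T, ∫ ω, N.inflowGE (x t ω) i (l + 1) ∂μ + T * ρ + b := by
      intro T
      have h := integral_mono (μ := μ) (integrable_finsetSum (Finset.range T) fun t _ => hio t)
        (((integrable_finsetSum (Finset.range T) fun t _ => hii t).add
          (integrable_finsetSum (Finset.range T) fun t _ => hia t)).add (integrable_const b))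
        (fun ω => sum_outflowGE_le (fun t => ha.nonneg t ω) (fun t => hx.policy.isFlow t ω)
          (fun t i l hl => hx.availability t ω i l hl) i l hl T)
      rw [integral_finsetSum _ fun t _ => hio t, integral_add'
        ((integrable_finsetSum (Finset.range T) fun t _ => hii t).add
          (integrable_finsetSum (Finset.range T) fun t _ => hia t)) (integrable_const b),
        integral_add' (integrable_finsetSum (Finset.range T) fun t _ => hii t)
          (integrable_finsetSum (Finset.range T) fun t _ => hia t),
        integral_finsetSum _ fun t _ => hii t, integral_finsetSum _ fun t _ => hia t] at h
      have hρ : ∀ t, ∫ ω, ∑ k ∈ Finset.Icc l N.L, a t ω i k ∂μ = ρ := fun t => by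
        rw [integral_finsetSum _ fun k _ => ha.integrable t i k]
        exact Finset.sum_congr rfl fun k _ => ha.integral_eq t i k
      simpa [hρ] using h
    have hb : Tendsto (fun T : ℕ => b / (T : ℝ)) f (𝓝 0) :=
      (tendsto_const_div_atTop_nhds_zero_nat b).mono_left hle
    have hR := ((hlim _ (N.inflowGE_mem_coordSpan i (l + 1))).add_const ρ).add hb
    rw [add_zero] at hR
    refine le_of_tendsto_of_tendsto (hlim _ (N.outflowGE_mem_coordSpan i l)) hR
      ((eventually_gt_atTop 0).filter_mono hle |>.mono fun T hT => ?_)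
    have hT' : (0 : ℝ) < T := by exact_mod_cast hT
    have := mul_le_mul_of_nonneg_left (hsum T) (by positivity : (0 : ℝ) ≤ 1 / T)
    refine this.trans_eq ?_
    field_simp

/-! ### Proportional routing -/

variable (N)

/-- The flow that sends the fraction `α i j l` of the backlog `Q i l` over the link `(i, j)`. -/
def splitFlow (α : FlowVec V) (Q : NodeVec V) : FlowVec V := fun i j l => α i j l * Q i l

open Classical in
/-- Backlogs under proportional routing with fractions `α`. -/
noncomputable def splitBacklog (α : FlowVec V) (q₀ : NodeVec V) (a : ℕ → NodeVec V) : ℕ → NodeVec V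
  | 0 => fun i l => if i ≠ N.dest ∧ l ∈ Finset.Icc 1 N.L then q₀ i l else 0
  | t + 1 => fun i l =>
      if i ≠ N.dest ∧ l ∈ Finset.Icc 1 N.L then
        splitBacklog α q₀ a t i (l + 1) -
          N.outflow (splitFlow α (splitBacklog α q₀ a t)) i (l + 1) +
          N.inflow (splitFlow α (splitBacklog α q₀ a t)) i (l + 1) + a t i l
      else 0

/-- The policy reads the backlogs that it creates itself. The recursion `splitBacklog` breaks this
circle, and it agrees with the backlogs of the resulting decisions. -/
theorem backlog_splitFlow (α : FlowVec V) (q₀ : NodeVec V) (a : ℕ → NodeVec V) (t : ℕ) :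
    N.backlog q₀ a (fun s => splitFlow α (N.splitBacklog α q₀ a s)) t =
      N.splitBacklog α q₀ a t := by
  induction t with
  | zero => rfl
  | succ t ih => funext i l; simp only [backlog, splitBacklog, ih]

theorem outflow_splitFlow (α : FlowVec V) (Q : NodeVec V) (i : V) (l : ℕ) :
    N.outflow (splitFlow α Q) i l = N.outflow α i l * Q i l := by
  simp only [outflow, splitFlow, Finset.sum_mul]

variable {N}

omit [Fintype V] in
theorem IsFlow.splitFlow {α : FlowVec V} (hα : N.IsFlow α) {Q : NodeVec V}
    (hQ : ∀ i l, 0 ≤ Q i l) : N.IsFlow (splitFlow α Q) where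
  nonneg i j l := mul_nonneg (hα.nonneg i j l) (hQ i l)
  off_links i j l h := by simp [PacketNetwork.splitFlow, hα.off_links i j l h]
  off_lifetimes i j l h := by simp [PacketNetwork.splitFlow, hα.off_lifetimes i j l h]
  dest_out j l := by simp [PacketNetwork.splitFlow, hα.dest_out j l]
  last_slot i j h := by simp [PacketNetwork.splitFlow, hα.last_slot i j h]

theorem splitBacklog_eq_zero (α : FlowVec V) (q₀ : NodeVec V) (a : ℕ → NodeVec V) (t : ℕ) (i : V)
    (l : ℕ) (h : ¬ (i ≠ N.dest ∧ l ∈ Finset.Icc 1 N.L)) : N.splitBacklog α q₀ a t i l = 0 := by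
  cases t <;> simp only [splitBacklog, if_neg h]

theorem splitBacklog_nonneg {α : FlowVec V} (hα : N.IsFlow α) (hα1 : ∀ i l, N.outflow α i l ≤ 1)
    {q₀ : NodeVec V} (hq₀ : ∀ i l, 0 ≤ q₀ i l) {a : ℕ → NodeVec V} (ha0 : ∀ t i l, 0 ≤ a t i l)
    (t : ℕ) (i : V) (l : ℕ) : 0 ≤ N.splitBacklog α q₀ a t i l := by
  induction t generalizing i l with
  | zero =>
    simp only [splitBacklog]
    split_ifs
    exacts [hq₀ i l, le_rfl]
  | succ t ih =>
    simp only [splitBacklog]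
    split_ifs
    · have h1 := (hα.splitFlow ih).inflow_nonneg i (l + 1)
      have h2 := mul_le_of_le_one_left (ih i (l + 1)) (hα1 i (l + 1))
      rw [outflow_splitFlow]
      linarith [ha0 t i l]
    · exact le_rfl

omit [Fintype V] in
theorem measurable_splitFlow (α : FlowVec V) {Q : Ω → NodeVec V}
    (hQ : ∀ i l, Measurable fun ω => Q ω i l) : Measurable fun ω => splitFlow α (Q ω) :=
  measurable_pi_lambda _ fun i => measurable_pi_lambda _ fun j =>
    measurable_pi_lambda _ fun l => (hQ i l).const_mul (α i j l)

/-- Causality of proportional routing: the backlogs of slot `t` depend only on arrivals of earlier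
slots. -/
theorem measurable_splitBacklog {μ : Measure Ω} {ℱ : Filtration ℕ mΩ} {a : ℕ → Ω → NodeVec V}
    (ha : N.IsArrivalStream μ ℱ a) (α : FlowVec V) (q₀ : NodeVec V) (t : ℕ) (i : V) (l : ℕ) :
    Measurable[ℱ t] (fun ω => N.splitBacklog α q₀ (fun s => a s ω) t i l) := by
  induction t generalizing i l with
  | zero => exact measurable_const
  | succ t ih =>
    have ih' : ∀ i l, Measurable[ℱ (t + 1)]
        (fun ω => N.splitBacklog α q₀ (fun s => a s ω) t i l) := fun i l =>
      (ih i l).mono (ℱ.mono t.le_succ) le_rfl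
    have h1 : Measurable[ℱ (t + 1)] (fun ω => a t ω i l) :=
      (measurable_pi_apply l).comp ((measurable_pi_apply i).comp (ha.adapted t))
    simp only [splitBacklog, outflow, inflow, splitFlow]
    split_ifs
    · exact (((ih' _ _).sub (Finset.measurable_fun_sum _ fun j _ => (ih' _ _).const_mul _)).add
        (Finset.measurable_fun_sum _ fun j _ => (ih' _ _).const_mul _)).add h1
    · exact measurable_const

theorem integrable_splitBacklog {μ : Measure Ω} [IsFiniteMeasure μ] {ℱ : Filtration ℕ mΩ}
    {a : ℕ → Ω → NodeVec V} (ha : N.IsArrivalStream μ ℱ a) (α : FlowVec V) (q₀ : NodeVec V)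
    (t : ℕ) (i : V) (l : ℕ) :
    Integrable (fun ω => N.splitBacklog α q₀ (fun s => a s ω) t i l) μ := by
  induction t generalizing i l with
  | zero => exact integrable_const _
  | succ t ih =>
    simp only [splitBacklog, outflow, inflow, splitFlow]
    split_ifs
    · exact (((ih _ _).sub (integrable_finsetSum _ fun j _ => (ih _ _).const_mul _)).add
        (integrable_finsetSum _ fun j _ => (ih _ _).const_mul _)).add (ha.integrable t i l)
    · exact integrable_const _

omit [Fintype V] in
theorem integral_splitFlow {μ : Measure Ω} (α : FlowVec V) (Q : Ω → NodeVec V) :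
    (fun i j l => ∫ ω, splitFlow α (Q ω) i j l ∂μ) = splitFlow α fun i l => ∫ ω, Q ω i l ∂μ := by
  funext i j l
  exact integral_const_mul _ _

/-- As the fractions are deterministic, the queue recursion is affine in backlogs and arrivals, so
the means satisfy it as well. -/
theorem integral_splitBacklog_succ {μ : Measure Ω} [IsFiniteMeasure μ] {ℱ : Filtration ℕ mΩ}
    {a : ℕ → Ω → NodeVec V} (ha : N.IsArrivalStream μ ℱ a) (α : FlowVec V) (q₀ : NodeVec V)
    (t : ℕ) (i : V) (l : ℕ) (hi : i ≠ N.dest) (hl : l ∈ Finset.Icc 1 N.L) (m : NodeVec V)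
    (hm : m = fun i l => ∫ ω, N.splitBacklog α q₀ (fun s => a s ω) t i l ∂μ) :
    ∫ ω, N.splitBacklog α q₀ (fun s => a s ω) (t + 1) i l ∂μ =
      m i (l + 1) - N.outflow (splitFlow α m) i (l + 1) + N.inflow (splitFlow α m) i (l + 1) +
        arrivalRate μ a i l := by
  have hQ := integrable_splitBacklog ha α q₀ t
  have hs : ∀ i j l, Integrable
      (fun ω => splitFlow α (N.splitBacklog α q₀ (fun s => a s ω) t) i j l) μ :=
    fun i j l => (hQ i l).const_mul _
  have ho := integrable_and_integral_of_mem_coordSpan (N.outflow_mem_coordSpan i (l + 1)) hs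
  have hI := integrable_and_integral_of_mem_coordSpan (N.inflow_mem_coordSpan i (l + 1)) hs
  simp only [splitBacklog, if_pos (And.intro hi hl)]
  refine (integral_add (((hQ i (l + 1)).sub ho.1).add hI.1) (ha.integrable t i l)).trans ?_
  rw [integral_add' ((hQ i (l + 1)).sub ho.1) hI.1, integral_sub' (hQ i (l + 1)) ho.1, ho.2, hI.2,
    integral_splitFlow, ha.integral_eq, hm]

/-- Fluid flows arise from proportional routing: there are stationary backlogs `Q` and routing
fractions `α` which produce the flow `y`. -/
theorem IsFluidFlow.exists_splitFlow_eq {r : NodeVec V} {θ : ℝ} {y : FlowVec V}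
    (hy : N.IsFluidFlow r θ y) :
    ∃ (α : FlowVec V) (Q : NodeVec V), N.IsFlow α ∧ (∀ i l, N.outflow α i l ≤ 1) ∧
      splitFlow α Q = y ∧ (∀ i l, N.L < l → Q i l = 0) ∧
      ∀ i, ∀ l ≤ N.L, Q i (l + 1) - N.outflow y i (l + 1) + N.inflow y i (l + 1) + r i l =
        Q i l := by
  have hyf := hy.isFlow
  let R : NodeVec V := fun i l => ∑ k ∈ Finset.Icc l N.L, r i k
  -- Unrolling the stationary queue equation down from lifetime `L` gives this backlog. Splitting
  -- off the term of lifetime `l` turns the causality constraint into `outflow ≤ Q`.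
  let Q : NodeVec V := fun i l => N.inflowGE y i (l + 1) - N.outflowGE y i (l + 1) + R i l
  have hQ : ∀ i, ∀ l ∈ Finset.Icc 1 N.L, N.outflow y i l ≤ Q i l := by
    intro i l hl
    have h1 := hy.causality i l hl
    unfold outflowGE at h1
    rw [sum_Icc_eq_add _ (Finset.mem_Icc.1 hl).2] at h1
    simp only [Q, R, outflowGE]
    linarith
  have hQtop : ∀ i l, N.L < l → Q i l = 0 := by
    intro i l hl
    simp only [Q, R, inflowGE, outflowGE]
    rw [Finset.Icc_eq_empty (by omega), Finset.Icc_eq_empty (by omega)]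
    simp
  have hQstep : ∀ i, ∀ l ≤ N.L, Q i (l + 1) - N.outflow y i (l + 1) + N.inflow y i (l + 1) +
      r i l = Q i l := by
    intro i l hl
    have hR : R i l = r i l + R i (l + 1) := sum_Icc_eq_add _ hl
    rcases Nat.eq_or_lt_of_le hl with rfl | h
    · have htop : N.L + 1 ∉ Finset.Icc 1 N.L := by simp
      have ho : N.outflow y i (N.L + 1) = 0 :=
        Finset.sum_eq_zero fun j _ => hyf.off_lifetimes _ _ _ htop
      have hI : N.inflow y i (N.L + 1) = 0 :=
        Finset.sum_eq_zero fun j _ => hyf.off_lifetimes _ _ _ htop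
      simp only [Q, hR, ho, hI, inflowGE, outflowGE]
      rw [Finset.Icc_eq_empty (by omega : ¬ N.L + 1 + 1 ≤ N.L),
        Finset.Icc_eq_empty (by omega : ¬ N.L + 1 ≤ N.L)]
      simp only [Finset.sum_empty]
      ring
    · simp only [Q, hR, inflowGE, outflowGE]
      rw [sum_Icc_eq_add (fun k => N.inflow y i k) h, sum_Icc_eq_add (fun k => N.outflow y i k) h]
      ring
  let α : FlowVec V := fun i j l => if l ∈ Finset.Icc 1 N.L then y i j l / Q i l else 0
  have hQ0 : ∀ i, ∀ l ∈ Finset.Icc 1 N.L, 0 ≤ Q i l := fun i l hl =>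
    (hyf.outflow_nonneg i l).trans (hQ i l hl)
  have hα : N.IsFlow α :=
    { nonneg := fun i j l => by
        simp only [α]
        split_ifs with hl
        exacts [div_nonneg (hyf.nonneg _ _ _) (hQ0 i l hl), le_rfl]
      off_links := fun i j l h => by simp [α, hyf.off_links i j l h]
      off_lifetimes := fun i j l h => by simp only [α, if_neg h]
      dest_out := fun j l => by simp [α, hyf.dest_out j l]
      last_slot := fun i j h => by simp [α, hyf.last_slot i j h] }
  have hα1 : ∀ i l, N.outflow α i l ≤ 1 := by
    intro i l
    by_cases hl : l ∈ Finset.Icc 1 N.L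
    · have : N.outflow α i l = N.outflow y i l / Q i l := by
        simp only [outflow, α, if_pos hl, Finset.sum_div]
      rw [this]
      exact div_le_one_of_le₀ (hQ i l hl) (hQ0 i l hl)
    · rw [show N.outflow α i l = 0 from Finset.sum_eq_zero fun j _ => hα.off_lifetimes _ _ _ hl]
      exact zero_le_one
  have hαQ : ∀ i j l, splitFlow α Q i j l = y i j l := by
    intro i j l
    simp only [splitFlow, α]
    split_ifs with hl
    -- Where `Q` vanishes the quotient is `0` by convention; this is harmless, since then `y`,
    -- bounded by `Q`, vanishes too.
    · refine div_mul_cancel_of_imp fun h0 => le_antisymm ?_ (hyf.nonneg _ _ _)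
      exact (hyf.le_outflow i j l).trans ((hQ i l hl).trans_eq h0)
    · rw [zero_mul, hyf.off_lifetimes i j l hl]
  exact ⟨α, Q, hα, hα1, by funext i j l; exact hαQ i j l, hQtop, hQstep⟩

/-- Under proportional routing, the mean flow becomes stationary after `L` slots. -/
theorem splitFlow_integral_splitBacklog {μ : Measure Ω} [IsFiniteMeasure μ] {ℱ : Filtration ℕ mΩ}
    {a : ℕ → Ω → NodeVec V} (ha : N.IsArrivalStream μ ℱ a) (q₀ : NodeVec V) {α : FlowVec V}
    (hα : N.IsFlow α) {Q : NodeVec V} (hQtop : ∀ i l, N.L < l → Q i l = 0)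
    (hQstep : ∀ i, ∀ l ≤ N.L, Q i (l + 1) - N.outflow (splitFlow α Q) i (l + 1) +
      N.inflow (splitFlow α Q) i (l + 1) + arrivalRate μ a i l = Q i l)
    {t : ℕ} (ht : N.L ≤ t) :
    splitFlow α (fun i l => ∫ ω, N.splitBacklog α q₀ (fun s => a s ω) t i l ∂μ) =
      splitFlow α Q := by
  let m : ℕ → NodeVec V := fun t i l => ∫ ω, N.splitBacklog α q₀ (fun s => a s ω) t i l ∂μ
  have hm0 : ∀ t i l, ¬ (i ≠ N.dest ∧ l ∈ Finset.Icc 1 N.L) → m t i l = 0 := by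
    intro t i l h
    simp only [m]
    rw [integral_congr_ae (ae_of_all _ fun ω => splitBacklog_eq_zero α q₀ _ t i l h)]
    simp
  -- The means and `Q` may differ at the destination and at lifetime `0`, but `α` vanishes there, so
  -- the flows still agree.
  have hsplit : ∀ t l, (∀ i, i ≠ N.dest → 1 ≤ l → m t i l = Q i l) →
      ∀ i j, splitFlow α (m t) i j l = splitFlow α Q i j l := by
    intro t l h i j
    by_cases hi : i = N.dest
    · simp [splitFlow, hi, hα.dest_out]
    · rcases Nat.eq_zero_or_pos l with rfl | hl
      · simp [splitFlow, hα.off_lifetimes i j 0 (by simp)]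
      · simp only [splitFlow, h i hi hl]
  -- At `t = 0` only lifetimes above `L` are covered, where both sides are zero. Each slot extends
  -- the agreement one lifetime lower, reaching lifetime `1` at slot `L`.
  have hmean : ∀ t i l, i ≠ N.dest → 1 ≤ l → N.L + 1 ≤ t + l → m t i l = Q i l := by
    intro t
    induction t with
    | zero =>
      intro i l hi hl h
      rw [hQtop i l (by omega), hm0]
      rintro ⟨-, h'⟩
      have := (Finset.mem_Icc.1 h').2
      omega
    | succ t ih =>
      intro i l hi hl h
      by_cases hL : l ≤ N.L
      · have hy' := hsplit t (l + 1) fun i hi _ => ih i (l + 1) hi (by omega) (by omega)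
        have h1 := integral_splitBacklog_succ ha α q₀ t i l hi (Finset.mem_Icc.2 ⟨hl, hL⟩) (m t) rfl
        have h2 : N.outflow (splitFlow α (m t)) i (l + 1) = N.outflow (splitFlow α Q) i (l + 1) :=
          Finset.sum_congr rfl fun j _ => hy' i j
        have h3 : N.inflow (splitFlow α (m t)) i (l + 1) = N.inflow (splitFlow α Q) i (l + 1) :=
          Finset.sum_congr rfl fun j _ => hy' j i
        rw [h2, h3, ih i (l + 1) hi (by omega) (by omega), hQstep i l hL] at h1
        exact h1
      · rw [hQtop i l (by omega), hm0]
        rintro ⟨-, h'⟩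
        exact hL (Finset.mem_Icc.1 h').2
  funext i j l
  exact hsplit t l (fun i hi hl => hmean t i l hi hl (by omega)) i j

/-- Availability holds on every path because the fractions sum to at most one. The random link flows
may exceed the capacity in some slots, but the actual network restricts only their average, which is
that of the fluid flow. -/
theorem IsFluidFlow.exists_feasibleActual {μ : Measure Ω} [IsProbabilityMeasure μ]
    {ℱ : Filtration ℕ mΩ} {a : ℕ → Ω → NodeVec V} (ha : N.IsArrivalStream μ ℱ a)
    {q₀ : NodeVec V} (hq₀ : ∀ i l, 0 ≤ q₀ i l) {γ : ℝ} {y : FlowVec V}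
    (hy : N.IsFluidFlow (arrivalRate μ a) (γ * N.totalRate μ a) y) :
    ∃ x, N.FeasibleActual μ ℱ a q₀ γ x ∧
      HasLongRunAvg μ (fun t ω => N.opCost (x t ω)) (N.opCost y) := by
  obtain ⟨α, Q, hα, hα1, rfl, hQtop, hQstep⟩ := hy.exists_splitFlow_eq
  let S : ℕ → Ω → NodeVec V := fun t ω => N.splitBacklog α q₀ (fun s => a s ω) t
  have hS0 : ∀ t ω i l, 0 ≤ S t ω i l := fun t ω =>
    splitBacklog_nonneg hα hα1 hq₀ (fun s => ha.nonneg s ω) t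
  have havg : ∀ φ ∈ coordSpan V,
      HasLongRunAvg μ (fun t ω => φ (splitFlow α (S t ω))) (φ (splitFlow α Q)) := by
    intro φ hφ
    refine hasLongRunAvg_of_eventually_eq ((eventually_ge_atTop N.L).mono fun t ht => ?_)
    have hs : ∀ i j l, Integrable (fun ω => splitFlow α (S t ω) i j l) μ := fun i j l =>
      (integrable_splitBacklog ha α q₀ t i l).const_mul _
    rw [(integrable_and_integral_of_mem_coordSpan hφ hs).2, integral_splitFlow]
    exact congrArg φ (splitFlow_integral_splitBacklog ha q₀ hα hQtop hQstep ht)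
  have hadapted : ∀ t, Measurable[ℱ t] fun ω => splitFlow α (S t ω) := fun t =>
    measurable_splitFlow (mΩ := ℱ t) α (measurable_splitBacklog ha α q₀ t)
  have havail : ∀ t ω i, ∀ l ∈ Finset.Icc 1 N.L, N.outflow (splitFlow α (S t ω)) i l ≤
      N.backlog q₀ (fun s => a s ω) (fun s => splitFlow α (S s ω)) t i l := fun t ω i l _ => by
    rw [outflow_splitFlow, backlog_splitFlow]
    exact mul_le_of_le_one_left (hS0 t ω i l) (hα1 i l)
  have hrel : N.Reliable μ a γ fun t ω => splitFlow α (S t ω) :=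
    ⟨N.delivered (splitFlow α Q), havg _ N.delivered_mem_coordSpan, hy.reliable⟩
  have hcap : ∀ i j, N.graph.Adj i j → ∃ c, HasLongRunAvg μ
      (fun t ω => N.linkFlow (splitFlow α (S t ω)) i j) c ∧ c ≤ N.cap i j := fun i j hij =>
    ⟨N.linkFlow (splitFlow α Q) i j, havg _ (N.linkFlow_mem_coordSpan i j), hy.capacity i j hij⟩
  exact ⟨fun t ω => splitFlow α (S t ω),
    ⟨⟨hadapted, fun t ω => hα.splitFlow (hS0 t ω)⟩, hrel, hcap, havail⟩,
    havg _ N.opCost_mem_coordSpan⟩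

end PacketNetwork

open PacketNetwork in
theorem PacketNetwork.attainedCosts_eq_image {V : Type*} [Fintype V] {N : PacketNetwork V}
    {Ω : Type*} {mΩ : MeasurableSpace Ω} {μ : Measure Ω} {F : (ℕ → Ω → FlowVec V) → Prop}
    {P : Set (FlowVec V)}
    (h₁ : ∀ x, F x → ∃ y ∈ P,
      ∀ c, HasLongRunAvg μ (fun t ω => N.opCost (x t ω)) c → N.opCost y = c)
    (h₂ : ∀ y ∈ P, ∃ x, F x ∧ HasLongRunAvg μ (fun t ω => N.opCost (x t ω)) (N.opCost y)) :
    N.attainedCosts μ F = N.opCost '' P := by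
  ext c
  constructor
  · rintro ⟨x, hx, hc⟩
    obtain ⟨y, hy, h⟩ := h₁ x hx
    exact ⟨y, hy, h c hc⟩
  · rintro ⟨y, hy, rfl⟩
    exact h₂ y hy

/-- The actual and the virtual network control problem have the same optimal value, and if one of
them is feasible, this value is a minimum that is attained in both. -/
theorem corollary1 {V : Type*} [Fintype V] (N : PacketNetwork V)
    {Ω : Type*} {mΩ : MeasurableSpace Ω} (μ : Measure Ω) [IsProbabilityMeasure μ]
    (ℱ : Filtration ℕ mΩ) (a : ℕ → Ω → NodeVec V) (ha : N.IsArrivalStream μ ℱ a)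
    (q₀ : NodeVec V) (hq₀ : ∀ i l, 0 ≤ q₀ i l) (γ : ℝ) :
    N.optimalValue μ (N.FeasibleActual μ ℱ a q₀ γ) =
        N.optimalValue μ (N.FeasibleVirtual μ ℱ a γ) ∧
      (((∃ x, N.FeasibleActual μ ℱ a q₀ γ x) ∨ ∃ x, N.FeasibleVirtual μ ℱ a γ x) →
        ∃ v : ℝ, IsLeast (N.attainedCosts μ (N.FeasibleActual μ ℱ a q₀ γ)) v ∧
          IsLeast (N.attainedCosts μ (N.FeasibleVirtual μ ℱ a γ)) v) := by
  let P : Set (FlowVec V) :=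
    {y | N.IsFluidFlow (PacketNetwork.arrivalRate μ a) (γ * N.totalRate μ a) y}
  have hA : N.attainedCosts μ (N.FeasibleActual μ ℱ a q₀ γ) = N.opCost '' P :=
    PacketNetwork.attainedCosts_eq_image (fun x hx => hx.exists_isFluidFlow ha hq₀)
      (fun y hy => hy.exists_feasibleActual ha hq₀)
  have hV : N.attainedCosts μ (N.FeasibleVirtual μ ℱ a γ) = N.opCost '' P :=
    PacketNetwork.attainedCosts_eq_image (fun x hx => hx.exists_isFluidFlow)
      (fun y hy => hy.exists_feasibleVirtual ℱ)
  refine ⟨by rw [PacketNetwork.optimalValue, PacketNetwork.optimalValue, hA, hV], fun h => ?_⟩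
  -- A feasible policy need not have a long-run average cost, but it always yields a fluid flow; so
  -- feasibility alone makes the common set of costs nonempty.
  have hne : P.Nonempty := by
    rcases h with ⟨x, hx⟩ | ⟨x, hx⟩
    · obtain ⟨y, hy, -⟩ := hx.exists_isFluidFlow ha hq₀
      exact ⟨y, hy⟩
    · obtain ⟨y, hy, -⟩ := hx.exists_isFluidFlow
      exact ⟨y, hy⟩
  have hK : IsCompact (N.opCost '' P) := (N.isCompact_setOf_isFluidFlow _ _).image
    (PacketNetwork.continuous_of_mem_coordSpan N.opCost_mem_coordSpan)
  obtain ⟨v, hv⟩ := hK.exists_isLeast (hne.image _)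
  exact ⟨v, by rwa [hA], by rwa [hV]⟩
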